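/- Let $R$ be an associative ring with unit (not necessarily commutative), let $R\text{-Mod}$ be the category of left $R$-modules, and let $(\mathcal A,\mathcal B)$ be a complete hereditary cotorsion pair in $R\text{-Mod}$. That is, $\mathcal A$ and $\mathcal B$ are classes of left $R$-modules such that: - (cotorsion pair) $\mathcal B$ is the class of all modules $Y$ with $\mathrm{Ext}^1_R(A,Y)=0$ for all $A\in\mathcal A$, and $\mathcal A$ is the class of all modules $L$ with $\mathrm{Ext}^1_R(L,B)=0$ for all $B\in\mathcal B$; - (hereditary) $\mathrm{Ext}^i_R(A,B)=0$ for all $A\in\mathcal A$, $B\in\mathcal B$ and $i\ge 1$; - (complete) for each module $M$ there are short exact sequences $0\to M\to B\to A\to 0$ and $0\to B'\to A'\to M\to 0$ with $A,A'\in\mathcal A$ and $B,B'\in\mathcal B$. Complexes are unbounded chain complexes $X=(\cdots\to X_{n+1}\to X_n\to X_{n-1}\to\cdots)_{n\in\mathbb Z}$ of left $R$-modules, with cycles $Z_n(X)=\ker(X_n\to X_{n-1})$. For a class $\mathcal C$ of modules let $dw(\mathcal C)$ be the class of complexes $X$ with $X_n\in\mathcal C$ for all $n\in\mathbb Z$,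 and let $\widetilde{\mathcal C}$ be the class of exact complexes $X$ with $Z_n(X)\in\mathcal C$ for all $n\in\mathbb Z$. Let $dg(\mathcal B)$ be the class of complexes $W\in dw(\mathcal B)$ such that every chain map $V\to W$ with $V\in\widetilde{\mathcal A}$ is null-homotopic. Then the following are equivalent: 1. Every exact complex $X$ with $X_n\in\mathcal A\cap\mathcal B$ for all $n$ satisfies $Z_n(X)\in\mathcal B$ for all $n$. 2. Every exact complex in $dw(\mathcal B)$ is in $\widetilde{\mathcal B}$. 3. Every complex in $dw(\mathcal B)$ is in $dg(\mathcal B)$. -/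

import Mathlib

open CategoryTheory

universe w v u

namespace Cotorsion

section Pairs

variable {C : Type u} [Category.{v} C] [Abelian C] [HasExt.{w} C]

/-- The right orthogonal class: all `Y` with `Ext¹(A, Y) = 0` for every `A` in the class `P`. -/
def rightPerp (P : ObjectProperty C) : ObjectProperty C :=
  fun Y => ∀ A : C, P A → Subsingleton (Abelian.Ext.{w} A Y 1)

/-- The left orthogonal class: all `L` with `Ext¹(L, B) = 0` for every `B` in the class `P`. -/
def leftPerp (P : ObjectProperty C) : ObjectProperty C :=
  fun L => ∀ B : C, P B → Subsingleton (Abelian.Ext.{w} L B 1)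

/-- `(A, B)` is a cotorsion pair: each class is the `Ext¹`-orthogonal of the other. -/
structure IsCotorsionPair (A B : ObjectProperty C) : Prop where
  right_eq : B = rightPerp.{w} A
  left_eq : A = leftPerp.{w} B

/-- Hereditary: `Ext^i(X, Y) = 0` for all `X` in `A`, `Y` in `B` and `i ≥ 1`. -/
def IsHereditary (A B : ObjectProperty C) : Prop :=
  ∀ X Y : C, A X → B Y → ∀ i : ℕ, 1 ≤ i → Subsingleton (Abelian.Ext.{w} X Y i)

end Pairs

section Complete

variable {C : Type u} [Category.{v} C] [Abelian C]

/-- Complete: every object `M` has short exact sequences `0 ⟶ M ⟶ Y ⟶ X ⟶ 0` and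
`0 ⟶ Y' ⟶ X' ⟶ M ⟶ 0` with `X`, `X'` in `A` and `Y`, `Y'` in `B`. -/
def IsComplete (A B : ObjectProperty C) : Prop :=
  ∀ M : C,
    (∃ (Y X : C) (f : M ⟶ Y) (g : Y ⟶ X) (h : f ≫ g = 0),
      B Y ∧ A X ∧ (ShortComplex.mk f g h).ShortExact) ∧
    (∃ (Y' X' : C) (f : Y' ⟶ X') (g : X' ⟶ M) (h : f ≫ g = 0),
      B Y' ∧ A X' ∧ (ShortComplex.mk f g h).ShortExact)

end Complete

section Complexes

variable {C : Type u} [Category.{v} C] [Abelian C]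

/-- `dw(P)`: the unbounded complexes all of whose components lie in `P`. -/
def dw (P : ObjectProperty C) : ObjectProperty (ChainComplex C ℤ) :=
  fun X => ∀ n : ℤ, P (X.X n)

/-- The exact complexes all of whose cycles lie in `P`. -/
def tilde (P : ObjectProperty C) : ObjectProperty (ChainComplex C ℤ) :=
  fun X => X.Acyclic ∧ ∀ n : ℤ, P (X.cycles n)

/-- The dg-`B` complexes of a pair `(A, B)`: the components lie in `B`, and every chain map from
an exact complex with cycles in `A` is null-homotopic. -/
def dgRight (A B : ObjectProperty C) : ObjectProperty (ChainComplex C ℤ) :=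
  fun W => dw B W ∧
    ∀ V : ChainComplex C ℤ, tilde A V → ∀ f : V ⟶ W, Nonempty (Homotopy f 0)

end Complexes

end Cotorsion

/-! Statements 1 and 3 reach 2 by one construction. Given an exact complex `X` in `dw B`, take
special `A`-precovers of its cycles and join them by a horseshoe argument. This gives a map `V ⟶ X`
with `V` exact, cycles of `V` in `A` and components in `A ⊓ B`, which on cycles is surjective with
kernel in `B` (`exists_tilde_precover`). Under 1 the cycles of `V` lie in `B`, hence so do their
quotients by objects of `B`. Under 3 the map is null-homotopic, so every map from an object of `A`
to `Zₙ(X)` lifts to `Xₙ₊₁`, which forces `Zₙ₊₁(X)` into `B`.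

For 2 → 3, each `W` in `dw B` receives a map from an acyclic `U` in `dw B` through which every map
from a complex in `tilde A` factors (`exists_acyclic_factorization`). By 2, `U` lies in `tilde B`,
and maps from `tilde A` to `tilde B` are null-homotopic (`nullHomotopic_of_tilde`). To build `U`,
kill the homology of `W` by the homotopy fiber of a map to a complex with zero differential and
components in `B`, iterate, and pass to the inverse limit. The transition maps vanish on homology,
so the limit is acyclic; their kernels lie in `B`, so its components stay in `B`. -/

namespace Cotorsion

/-! ### Long exact sequences of Ext -/

section ExtLemmas

open Abelian

variable {C : Type u} [Category.{v} C] [Abelian C] [HasExt.{w} C]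
variable {S : ShortComplex C} (hS : S.ShortExact)

include hS

lemma subsingleton_ext_middle_right {L : C} {n : ℕ} (h₁ : Subsingleton (Ext.{w} L S.X₁ n))
    (h₃ : Subsingleton (Ext.{w} L S.X₃ n)) : Subsingleton (Ext.{w} L S.X₂ n) := by
  refine subsingleton_of_forall_eq 0 fun x => ?_
  obtain ⟨y, rfl⟩ := Ext.covariant_sequence_exact₂ L hS x (Subsingleton.elim _ _)
  rw [Subsingleton.elim y 0, Ext.zero_comp]

lemma subsingleton_ext_middle_left {Y : C} {n : ℕ} (h₁ : Subsingleton (Ext.{w} S.X₁ Y n))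
    (h₃ : Subsingleton (Ext.{w} S.X₃ Y n)) : Subsingleton (Ext.{w} S.X₂ Y n) := by
  refine subsingleton_of_forall_eq 0 fun x => ?_
  obtain ⟨y, rfl⟩ := Ext.contravariant_sequence_exact₂ hS Y x (Subsingleton.elim _ _)
  rw [Subsingleton.elim y 0, Ext.comp_zero]

lemma subsingleton_ext_quotient_right {L : C} {n : ℕ} (h₁ : Subsingleton (Ext.{w} L S.X₁ (n + 1)))
    (h₂ : Subsingleton (Ext.{w} L S.X₂ n)) : Subsingleton (Ext.{w} L S.X₃ n) := by
  refine subsingleton_of_forall_eq 0 fun x => ?_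
  obtain ⟨y, rfl⟩ := Ext.covariant_sequence_exact₃ L hS x rfl (Subsingleton.elim _ _)
  rw [Subsingleton.elim y 0, Ext.zero_comp]

lemma subsingleton_ext_sub_left {Y : C} {n : ℕ} (h₃ : Subsingleton (Ext.{w} S.X₃ Y (1 + n)))
    (h₂ : Subsingleton (Ext.{w} S.X₂ Y n)) : Subsingleton (Ext.{w} S.X₁ Y n) := by
  refine subsingleton_of_forall_eq 0 fun x => ?_
  obtain ⟨y, rfl⟩ := Ext.contravariant_sequence_exact₁ hS Y x rfl (Subsingleton.elim _ _)
  rw [Subsingleton.elim y 0, Ext.comp_zero]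

lemma exists_extension_of_subsingleton_ext {Y : C} (h : Subsingleton (Ext.{w} S.X₃ Y 1))
    (g : S.X₁ ⟶ Y) : ∃ k : S.X₂ ⟶ Y, S.f ≫ k = g := by
  obtain ⟨y, hy⟩ := Ext.contravariant_sequence_exact₁ hS Y (Ext.mk₀ g) (n₁ := 1) rfl
    (Subsingleton.elim _ _)
  obtain ⟨k, rfl⟩ := Ext.addEquiv₀.symm.surjective y
  refine ⟨k, Ext.addEquiv₀.symm.injective ?_⟩
  simpa using hy

lemma exists_lift_of_subsingleton_ext {L : C} (h : Subsingleton (Ext.{w} L S.X₁ 1))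
    (g : L ⟶ S.X₃) : ∃ k : L ⟶ S.X₂, k ≫ S.g = g := by
  obtain ⟨y, hy⟩ := Ext.covariant_sequence_exact₃ L hS (Ext.mk₀ g) (n₁ := 1) rfl
    (Subsingleton.elim _ _)
  obtain ⟨k, rfl⟩ := Ext.addEquiv₀.symm.surjective y
  refine ⟨k, Ext.addEquiv₀.symm.injective ?_⟩
  simpa using hy

/-- Since `Ext¹(X₂, Y)` vanishes, every class in `Ext¹(X₃, Y)` comes from a map `X₁ ⟶ Y` by the
connecting homomorphism, which kills the maps that extend to `X₂`. -/
lemma subsingleton_ext_of_forall_exists_extension {Y : C}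
    (h₂ : Subsingleton (Ext.{w} S.X₂ Y 1))
    (h : ∀ g : S.X₁ ⟶ Y, ∃ k : S.X₂ ⟶ Y, S.f ≫ k = g) : Subsingleton (Ext.{w} S.X₃ Y 1) := by
  refine subsingleton_of_forall_eq 0 fun x => ?_
  obtain ⟨y, rfl⟩ := Ext.contravariant_sequence_exact₃ hS Y x (n₀ := 0) (Subsingleton.elim _ _) rfl
  obtain ⟨g, rfl⟩ := Ext.addEquiv₀.symm.surjective y
  obtain ⟨k, rfl⟩ := h g
  rw [Ext.addEquiv₀_symm_apply, ← Ext.mk₀_comp_mk₀, hS.extClass_comp_assoc]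

lemma subsingleton_ext_of_forall_exists_lift {L : C}
    (h₂ : Subsingleton (Ext.{w} L S.X₂ 1))
    (h : ∀ g : L ⟶ S.X₃, ∃ k : L ⟶ S.X₂, k ≫ S.g = g) : Subsingleton (Ext.{w} L S.X₁ 1) := by
  refine subsingleton_of_forall_eq 0 fun x => ?_
  obtain ⟨y, rfl⟩ := Ext.covariant_sequence_exact₁ L hS x (n₀ := 0) (Subsingleton.elim _ _) rfl
  obtain ⟨g, rfl⟩ := Ext.addEquiv₀.symm.surjective y
  obtain ⟨k, rfl⟩ := h g
  rw [Ext.addEquiv₀_symm_apply, ← Ext.mk₀_comp_mk₀, Ext.comp_assoc_of_second_deg_zero,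
    hS.comp_extClass, Ext.comp_zero]

end ExtLemmas

/-- A short exact sequence of modules, expressed by elements. -/
structure IsSES {R : Type u} [Ring R] {X Y Z : ModuleCat.{v} R} (f : X ⟶ Y) (g : Y ⟶ Z) :
    Prop where
  inj : Function.Injective f
  exact : Function.Exact f g
  surj : Function.Surjective g

/-! ### Cotorsion pairs in terms of extension and lifting of maps -/

section Modules

variable {R : Type u} [Ring R]

lemma IsSES.comp_eq_zero {X Y Z : ModuleCat.{v} R} {f : X ⟶ Y} {g : Y ⟶ Z} (h : IsSES f g) :
    f ≫ g = 0 := by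
  ext x
  exact h.exact.apply_apply_eq_zero x

lemma IsSES.shortExact {X Y Z : ModuleCat.{v} R} {f : X ⟶ Y} {g : Y ⟶ Z} (h : IsSES f g) :
    (ShortComplex.mk f g h.comp_eq_zero).ShortExact where
  exact := (ShortComplex.ShortExact.moduleCat_exact_iff_function_exact _).2 h.exact
  mono_f := (ModuleCat.mono_iff_injective _).2 h.inj
  epi_g := (ModuleCat.epi_iff_surjective _).2 h.surj

lemma IsSES.of_shortExact {S : ShortComplex (ModuleCat.{v} R)} (h : S.ShortExact) :
    IsSES S.f S.g where
  inj := (ModuleCat.mono_iff_injective _).1 h.mono_f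
  exact := (ShortComplex.ShortExact.moduleCat_exact_iff_function_exact _).1 h.exact
  surj := (ModuleCat.epi_iff_surjective _).1 h.epi_g

lemma isSES_ker {Y Z : ModuleCat.{v} R} (g : Y ⟶ Z) (hg : Function.Surjective g) :
    IsSES (ModuleCat.ofHom (LinearMap.ker g.hom).subtype) g where
  inj := Subtype.val_injective
  exact y := ⟨fun hy => ⟨⟨y, hy⟩, rfl⟩, by rintro ⟨x, rfl⟩; exact x.2⟩
  surj := hg

/-- The properties of the two classes of a complete hereditary cotorsion pair of modules that
are used below. -/
structure CotorsionData (A B : ObjectProperty (ModuleCat.{u} R)) : Prop where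
  extend : ∀ {X Y Z W : ModuleCat.{u} R} {f : X ⟶ Y} {g : Y ⟶ Z}, IsSES f g → A Z → B W →
    ∀ k : X ⟶ W, ∃ l : Y ⟶ W, f ≫ l = k
  lift : ∀ {X Y Z W : ModuleCat.{u} R} {f : X ⟶ Y} {g : Y ⟶ Z}, IsSES f g → B X → A W →
    ∀ k : W ⟶ Z, ∃ l : W ⟶ Y, l ≫ g = k
  right_of_extend : ∀ {W : ModuleCat.{u} R}, (∀ {X Y Z : ModuleCat.{u} R} {f : X ⟶ Y} {g : Y ⟶ Z},
    IsSES f g → A Z → ∀ k : X ⟶ W, ∃ l : Y ⟶ W, f ≫ l = k) → B W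
  right_of_lift : ∀ {X Y Z : ModuleCat.{u} R} {f : X ⟶ Y} {g : Y ⟶ Z}, IsSES f g → B Y →
    (∀ {W : ModuleCat.{u} R}, A W → ∀ k : W ⟶ Z, ∃ l : W ⟶ Y, l ≫ g = k) → B X
  left_middle : ∀ {X Y Z : ModuleCat.{u} R} {f : X ⟶ Y} {g : Y ⟶ Z}, IsSES f g → A X → A Z → A Y
  right_middle : ∀ {X Y Z : ModuleCat.{u} R} {f : X ⟶ Y} {g : Y ⟶ Z}, IsSES f g → B X → B Z → B Y
  left_sub : ∀ {X Y Z : ModuleCat.{u} R} {f : X ⟶ Y} {g : Y ⟶ Z}, IsSES f g → A Y → A Z → A X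
  right_quotient : ∀ {X Y Z : ModuleCat.{u} R} {f : X ⟶ Y} {g : Y ⟶ Z},
    IsSES f g → B X → B Y → B Z
  left_of_projective : ∀ (P : ModuleCat.{u} R) [Projective P], A P
  left_of_iso : ∀ {X Y : ModuleCat.{u} R}, (X ≅ Y) → A X → A Y
  precover : ∀ M : ModuleCat.{u} R, ∃ (K L : ModuleCat.{u} R) (f : K ⟶ L) (g : L ⟶ M),
    B K ∧ A L ∧ IsSES f g
  preenvelope : ∀ M : ModuleCat.{u} R, ∃ (Y : ModuleCat.{u} R) (f : M ⟶ Y),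
    B Y ∧ Function.Injective f

lemma exists_projective_isSES (M : ModuleCat.{u} R) :
    ∃ (P N : ModuleCat.{u} R) (f : N ⟶ P) (g : P ⟶ M), Projective P ∧ IsSES f g :=
  ⟨Projective.over M, _, _, Projective.π M, inferInstance,
    isSES_ker _ ((ModuleCat.epi_iff_surjective _).1 (Projective.π_epi M))⟩

/-- From here on Ext enters only through these properties. Heredity beyond degree 1 is needed for
`left_sub` and `right_quotient` alone, where `Ext²` must vanish. -/
theorem IsCotorsionPair.cotorsionData {A B : ObjectProperty (ModuleCat.{u} R)}
    (hpair : IsCotorsionPair.{u} A B) (hcomplete : IsComplete A B)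
    (hher : IsHereditary.{u} A B) : CotorsionData A B where
  extend h hA hB := exists_extension_of_subsingleton_ext h.shortExact (hher _ _ hA hB 1 le_rfl)
  lift h hB hA := exists_lift_of_subsingleton_ext h.shortExact (hher _ _ hA hB 1 le_rfl)
  right_of_extend {W} H := by
    rw [hpair.right_eq]
    intro L hL
    obtain ⟨P, N, f, g, hP, h⟩ := exists_projective_isSES L
    exact subsingleton_ext_of_forall_exists_extension h.shortExact
      (Abelian.Ext.subsingleton_of_projective P W 0) (H h hL)
  right_of_lift h hY H := by
    rw [hpair.right_eq]
    intro L hL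
    exact subsingleton_ext_of_forall_exists_lift h.shortExact (hher _ _ hL hY 1 le_rfl) (H hL)
  left_middle h hX hZ := by
    rw [hpair.left_eq]
    intro Y hY
    exact subsingleton_ext_middle_left h.shortExact (hher _ _ hX hY 1 le_rfl)
      (hher _ _ hZ hY 1 le_rfl)
  right_middle h hX hZ := by
    rw [hpair.right_eq]
    intro L hL
    exact subsingleton_ext_middle_right h.shortExact (hher _ _ hL hX 1 le_rfl)
      (hher _ _ hL hZ 1 le_rfl)
  left_sub h hY hZ := by
    rw [hpair.left_eq]
    intro W hW
    exact subsingleton_ext_sub_left h.shortExact (hher _ _ hZ hW 2 (by norm_num))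
      (hher _ _ hY hW 1 le_rfl)
  right_quotient h hX hY := by
    rw [hpair.right_eq]
    intro L hL
    exact subsingleton_ext_quotient_right h.shortExact (hher _ _ hL hX 2 (by norm_num))
      (hher _ _ hL hY 1 le_rfl)
  left_of_projective P _ := by
    rw [hpair.left_eq]
    intro Y _
    exact Abelian.Ext.subsingleton_of_projective P Y 0
  left_of_iso {X Y} e hX := by
    rw [hpair.left_eq]
    intro W hW
    have := hher _ _ hX hW 1 le_rfl
    refine subsingleton_of_forall_eq 0 fun x => ?_
    have h : (Abelian.Ext.mk₀ e.inv).comp ((Abelian.Ext.mk₀ e.hom).comp x (zero_add 1))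
        (zero_add 1) = x := by simp
    rw [← h, Subsingleton.elim ((Abelian.Ext.mk₀ e.hom).comp x (zero_add 1)) 0,
      Abelian.Ext.comp_zero]
  precover M := by
    obtain ⟨K, L, f, g, h, hK, hL, H⟩ := (hcomplete M).2
    exact ⟨K, L, f, g, hK, hL, IsSES.of_shortExact H⟩
  preenvelope M := by
    obtain ⟨Y, L, f, g, h, hY, -, H⟩ := (hcomplete M).1
    exact ⟨Y, f, hY, (IsSES.of_shortExact H).inj⟩

end Modules

/-! ### Cycles of acyclic complexes of modules -/

section Complexes

variable {R : Type u} [Ring R] (X : ChainComplex (ModuleCat.{v} R) ℤ)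

lemma iCycles_injective (n : ℤ) : Function.Injective (X.iCycles n) :=
  (ModuleCat.mono_iff_injective _).1 inferInstance

lemma exact_iCycles_d {i j : ℤ} (hij : j + 1 = i) :
    Function.Exact (X.iCycles i) (X.d i j) := by
  have h : (ShortComplex.mk (X.iCycles i) (X.d i j) (X.iCycles_d i j)).Exact :=
    ShortComplex.exact_of_f_is_kernel _
      (X.cyclesIsKernel i j ((ComplexShape.down ℤ).next_eq' hij))
  exact (ShortComplex.ShortExact.moduleCat_exact_iff_function_exact _).1 h

lemma exactAt_iff_exact {i j k : ℤ} (hij : j + 1 = i) (hjk : k + 1 = j) :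
    X.ExactAt j ↔ Function.Exact (X.d i j) (X.d j k) := by
  rw [X.exactAt_iff' i j k ((ComplexShape.down ℤ).prev_eq' hij)
    ((ComplexShape.down ℤ).next_eq' hjk)]
  exact ShortComplex.ShortExact.moduleCat_exact_iff_function_exact _

variable {X}

lemma acyclic_exact (hX : X.Acyclic) {i j k : ℤ} (hij : j + 1 = i) (hjk : k + 1 = j) :
    Function.Exact (X.d i j) (X.d j k) :=
  (exactAt_iff_exact X hij hjk).1 (hX j)

lemma toCycles_iCycles_apply {i j : ℤ} (x : X.X i) :
    X.iCycles j (X.toCycles i j x) = X.d i j x := by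
  rw [← ConcreteCategory.comp_apply, X.toCycles_i]

lemma toCycles_surjective (hX : X.Acyclic) {i j : ℤ} (hij : j + 1 = i) :
    Function.Surjective (X.toCycles i j) := by
  intro z
  have hz : X.d j (j - 1) (X.iCycles j z) = 0 :=
    (exact_iCycles_d X (by lia)).apply_apply_eq_zero z
  obtain ⟨x, hx⟩ := (acyclic_exact hX hij (by lia) _).1 hz
  exact ⟨x, iCycles_injective X j (by rw [toCycles_iCycles_apply, hx])⟩

lemma isSES_cycles (hX : X.Acyclic) {i j : ℤ} (hij : j + 1 = i) :
    IsSES (X.iCycles i) (X.toCycles i j) where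
  inj := iCycles_injective X i
  exact x := by
    rw [← exact_iCycles_d X hij x, ← toCycles_iCycles_apply,
      map_eq_zero_iff _ (iCycles_injective X j)]
  surj := toCycles_surjective hX hij

end Complexes

/-! ### Splicing short exact sequences into an acyclic complex -/

section Splice

variable {R : Type u} [Ring R] {Z E : ℤ → ModuleCat.{v} R}
  (i : ∀ n, Z (n + 1) ⟶ E n) (p : ∀ n, E n ⟶ Z n) (h : ∀ n, IsSES (i n) (p n))

include h in
lemma splice_d_comp_d (n : ℤ) : (p (n + 1 + 1) ≫ i (n + 1)) ≫ p (n + 1) ≫ i n = 0 := by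
  rw [Category.assoc, ← Category.assoc (i (n + 1)), (h (n + 1)).comp_eq_zero]
  simp

/-- The complex obtained by splicing the short exact sequences
`0 ⟶ Z (n + 1) ⟶ E n ⟶ Z n ⟶ 0`. -/
noncomputable abbrev splice : ChainComplex (ModuleCat.{v} R) ℤ :=
  ChainComplex.of E (fun n => p (n + 1) ≫ i n) (splice_d_comp_d i p h)

lemma splice_d (n : ℤ) : (splice i p h).d (n + 1) n = p (n + 1) ≫ i n :=
  ChainComplex.of_d E (fun n => p (n + 1) ≫ i n) n

lemma splice_d_eq_zero_iff (n : ℤ) (x : (splice i p h).X (n + 1)) :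
    (splice i p h).d (n + 1) n x = 0 ↔ ∃ z, i (n + 1) z = x := by
  rw [splice_d, ConcreteCategory.comp_apply, map_eq_zero_iff _ (h n).inj]
  exact (h (n + 1)).exact x

lemma splice_acyclic : (splice i p h).Acyclic := by
  intro j
  obtain ⟨k, rfl⟩ : ∃ k, j = k + 1 := ⟨j - 1, by lia⟩
  rw [exactAt_iff_exact _ rfl rfl]
  intro x
  rw [splice_d_eq_zero_iff, splice_d]
  constructor
  · rintro ⟨z, rfl⟩
    obtain ⟨y, rfl⟩ := (h _).surj z
    exact ⟨y, rfl⟩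
  · rintro ⟨y, rfl⟩
    exact ⟨p _ y, rfl⟩

/-- The index shifts by one: `Z n` is the image of the differential leaving degree `n`, so it is the
module of cycles in degree `n - 1`. -/
lemma exists_splice_cyclesIso (n : ℤ) :
    ∃ e : Z (n + 1) ≅ (splice i p h).cycles n, e.hom ≫ (splice i p h).iCycles n = i n := by
  obtain ⟨m, rfl⟩ : ∃ k, n = k + 1 := ⟨n - 1, by lia⟩
  set X := splice i p h
  have h₀ : i (m + 1) ≫ X.d (m + 1) m = 0 := by
    ext z
    exact (splice_d_eq_zero_iff i p h m _).2 ⟨z, rfl⟩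
  let f : Z (m + 1 + 1) ⟶ X.cycles (m + 1) :=
    X.liftCycles (i (m + 1)) m ((ComplexShape.down ℤ).next_eq' rfl) h₀
  have hf : f ≫ X.iCycles (m + 1) = i (m + 1) := X.liftCycles_i _ _ _ _
  have hf' : ∀ z, X.iCycles (m + 1) (f z) = i (m + 1) z := fun z => by
    rw [← hf]; rfl
  have : IsIso f := by
    rw [ConcreteCategory.isIso_iff_bijective]
    constructor
    · intro a b hab
      apply (h _).inj
      rw [← hf', ← hf', hab]
    · intro z
      obtain ⟨w, hw⟩ := (splice_d_eq_zero_iff i p h m _).1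
        ((exact_iCycles_d X rfl).apply_apply_eq_zero z)
      exact ⟨w, iCycles_injective X _ (by rw [hf', hw])⟩
  exact ⟨asIso f, hf⟩

end Splice

/-! ### Special precovers of exact complexes -/

section Horseshoe

variable {R : Type u} [Ring R]

lemma IsSES.exists_lift {X Y Z W : ModuleCat.{v} R} {f : X ⟶ Y} {g : Y ⟶ Z} (h : IsSES f g)
    (k : W ⟶ Y) (hk : k ≫ g = 0) : ∃ l : W ⟶ X, l ≫ f = k :=
  have := h.shortExact.mono_f
  ⟨h.shortExact.exact.lift k hk, h.shortExact.exact.lift_f k hk⟩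

lemma IsSES.exists_desc {X Y Z W : ModuleCat.{v} R} {f : X ⟶ Y} {g : Y ⟶ Z} (h : IsSES f g)
    (k : Y ⟶ W) (hk : f ≫ k = 0) : ∃ l : Z ⟶ W, g ≫ l = k :=
  have := h.shortExact.epi_g
  ⟨h.shortExact.exact.desc k hk, h.shortExact.exact.g_desc k hk⟩

lemma comp_apply_of_eq {X Y Z : ModuleCat.{v} R} {f : X ⟶ Y} {g : Y ⟶ Z} {k : X ⟶ Z}
    (h : f ≫ g = k) (x : X) : g (f x) = k x := by
  rw [← h]; rfl

lemma comp_apply_of_sq {X Y Y' Z : ModuleCat.{v} R} {f : X ⟶ Y} {g : Y ⟶ Z} {f' : X ⟶ Y'}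
    {g' : Y' ⟶ Z} (h : f ≫ g = f' ≫ g') (x : X) : g (f x) = g' (f' x) :=
  comp_apply_of_eq h x

/-- Pushing out a short exact sequence `0 ⟶ N ⟶ P ⟶ L ⟶ 0` along a map `N ⟶ M`. -/
lemma IsSES.exists_pushout {N P L M : ModuleCat.{v} R} {n : N ⟶ P} {q : P ⟶ L} (h : IsSES n q)
    (r : N ⟶ M) : ∃ (E : ModuleCat.{v} R) (a : M ⟶ E) (b : E ⟶ L), IsSES a b ∧
      ∀ (X : ModuleCat.{v} R) (s : M ⟶ X) (t : P ⟶ X), r ≫ s = n ≫ t →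
        ∃ φ : E ⟶ X, a ≫ φ = s ∧ ∀ (Y : ModuleCat.{v} R) (u : X ⟶ Y) (w : L ⟶ Y),
          s ≫ u = 0 → t ≫ u = q ≫ w → φ ≫ u = b ≫ w := by
  let S : Submodule R (M × P) := LinearMap.range (r.hom.prod (-n.hom))
  have mkeq : ∀ x : N, S.mkQ (r x, 0) = S.mkQ (0, n x) := fun x => by
    rw [← sub_eq_zero, ← map_sub, Submodule.mkQ_apply, Submodule.Quotient.mk_eq_zero]
    exact ⟨x, by simp⟩
  have hS : ∀ {X : ModuleCat.{v} R} (s : M ⟶ X) (t : P ⟶ X), r ≫ s = n ≫ t →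
      S ≤ LinearMap.ker (s.hom.coprod t.hom) := by
    rintro X s t hst _ ⟨x, rfl⟩
    have := comp_apply_of_sq hst x
    simp [this]
  have h0 : r ≫ (0 : M ⟶ L) = n ≫ q := by rw [h.comp_eq_zero, Limits.comp_zero]
  refine ⟨ModuleCat.of R ((M × P) ⧸ S), ModuleCat.ofHom (S.mkQ ∘ₗ LinearMap.inl R M P),
    ModuleCat.ofHom (S.liftQ _ (hS 0 q h0)), ⟨?_, ?_, ?_⟩, ?_⟩
  · rw [injective_iff_map_eq_zero]
    intro m hm
    have hm' : S.mkQ (m, 0) = 0 := hm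
    rw [Submodule.mkQ_apply, Submodule.Quotient.mk_eq_zero] at hm'
    obtain ⟨x, hx⟩ := hm'
    have h1 : r x = m := congrArg Prod.fst hx
    have h2 : -n x = 0 := congrArg Prod.snd hx
    have h3 : x = 0 := h.inj (by rw [neg_eq_zero.1 h2, map_zero])
    rw [← h1, h3, map_zero]
  · intro e
    obtain ⟨⟨m, p⟩, rfl⟩ := S.mkQ_surjective e
    have hb : (ModuleCat.ofHom (S.liftQ _ (hS 0 q h0))) (S.mkQ (m, p)) = q p := by
      change S.liftQ _ (hS 0 q h0) (S.mkQ (m, p)) = _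
      simp
    rw [hb]
    constructor
    · intro hp
      obtain ⟨x, rfl⟩ := (h.exact p).1 hp
      refine ⟨m + r x, ?_⟩
      change S.mkQ (m + r x, 0) = _
      have : (m, n x) = (m, 0) + ((0, n x) : M × P) := by simp
      rw [this, map_add, ← mkeq, ← map_add]
      simp
    · rintro ⟨y, hy⟩
      rw [← hb, ← hy]
      change S.liftQ _ (hS 0 q h0) (S.mkQ (y, 0)) = _
      simp
  · intro l
    obtain ⟨p, rfl⟩ := h.surj l
    refine ⟨S.mkQ (0, p), ?_⟩
    change S.liftQ _ (hS 0 q h0) (S.mkQ (0, p)) = _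
    simp
  · intro X s t hst
    refine ⟨ModuleCat.ofHom (S.liftQ _ (hS s t hst)), ?_, ?_⟩
    · ext m
      change S.liftQ _ (hS s t hst) (S.mkQ (m, 0)) = _
      simp
    · intro Y u w hsu htu
      refine ModuleCat.hom_ext (LinearMap.ext fun e => ?_)
      obtain ⟨⟨m, p⟩, rfl⟩ := S.mkQ_surjective e
      change u (S.liftQ _ (hS s t hst) (S.mkQ (m, p))) =
        w (S.liftQ _ (hS 0 q h0) (S.mkQ (m, p)))
      have h1 := comp_apply_of_eq hsu m
      have h2 := comp_apply_of_sq htu p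
      simp [h1, h2]

variable {A B : ObjectProperty (ModuleCat.{u} R)} (D : CotorsionData A B)
include D

/-- The middle term of a morphism of short exact sequences whose outer components are surjective
with kernels in `B` is in `B` as soon as the middle target is. -/
lemma CotorsionData.right_of_ses_map {X' X X'' K' L' K L E : ModuleCat.{u} R}
    {f' : X' ⟶ X} {f : X ⟶ X''} (hf : IsSES f' f)
    {k' : K' ⟶ L'} {g' : L' ⟶ X'} (hg' : IsSES k' g') {k : K ⟶ L} {g : L ⟶ X''}
    (hg : IsSES k g) {a : L' ⟶ E} {b : E ⟶ L} (hab : IsSES a b) {φ : E ⟶ X}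
    (ha : a ≫ φ = g' ≫ f') (hb : φ ≫ f = b ≫ g) (hK' : B K') (hK : B K) (hX : B X) : B E := by
  have ha' := comp_apply_of_sq ha
  have hb' := comp_apply_of_sq hb
  have hφ : Function.Surjective φ := by
    intro x
    obtain ⟨l, hl⟩ := hg.surj (f x)
    obtain ⟨e, rfl⟩ := hab.surj l
    obtain ⟨x', hx'⟩ := (hf.exact (x - φ e)).1 (by rw [map_sub, hb', hl, sub_self])
    obtain ⟨l', rfl⟩ := hg'.surj x'
    exact ⟨a l' + e, by rw [map_add, ha', hx', sub_add_cancel]⟩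
  have hker := isSES_ker φ hφ
  set S := ModuleCat.of R (LinearMap.ker φ.hom)
  set ι : S ⟶ E := ModuleCat.ofHom (LinearMap.ker φ.hom).subtype
  obtain ⟨c, hc⟩ := hker.exists_lift (k' ≫ a) (by
    rw [Category.assoc, ha, ← Category.assoc, hg'.comp_eq_zero, Limits.zero_comp])
  obtain ⟨d, hd⟩ := hg.exists_lift (ι ≫ b) (by
    rw [Category.assoc, ← hb, ← Category.assoc, hker.comp_eq_zero, Limits.zero_comp])
  have hc' := comp_apply_of_sq hc
  have hd' := comp_apply_of_sq hd
  -- By the snake lemma the kernel of `φ` is an extension of `K` by `K'`, and `E` is an extension of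
  -- `X` by that kernel.
  refine D.right_middle hker (D.right_middle (f := c) (g := d) ⟨?_, ?_, ?_⟩ hK' hK) hX
  · intro x y hxy
    apply hg'.inj
    apply hab.inj
    rw [← hc', ← hc', hxy]
  · intro s
    constructor
    · intro hs
      have h1 : b (ι s) = 0 := by rw [← hd', hs, map_zero]
      obtain ⟨l', hl'⟩ := (hab.exact _).1 h1
      have h2 : g' l' = 0 := hf.inj (by
        rw [← ha', hl', map_zero]
        exact hker.exact.apply_apply_eq_zero s)
      obtain ⟨x, rfl⟩ := (hg'.exact _).1 h2
      exact ⟨x, hker.inj (by rw [hc', hl'])⟩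
    · rintro ⟨x, rfl⟩
      exact hg.inj (by rw [hd', hc', map_zero]; exact hab.exact.apply_apply_eq_zero _)
  · intro x
    obtain ⟨e, he⟩ := hab.surj (k x)
    have h1 : f (φ e) = 0 := by
      rw [hb', he]
      exact hg.exact.apply_apply_eq_zero x
    obtain ⟨x', hx'⟩ := (hf.exact _).1 h1
    obtain ⟨l', rfl⟩ := hg'.surj x'
    obtain ⟨s, hs⟩ := (hker.exact (e - a l')).1 (by rw [map_sub, ha', hx', sub_self])
    have h2 : b (a l') = 0 := hab.exact.apply_apply_eq_zero _
    exact ⟨s, hg.inj (by rw [hd', hs, map_sub, he, h2, sub_zero])⟩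

/-- The horseshoe lemma for special `A`-precovers. -/
lemma CotorsionData.horseshoe {X' X X'' K' L' K L : ModuleCat.{u} R}
    {f' : X' ⟶ X} {f : X ⟶ X''} (hf : IsSES f' f)
    {k' : K' ⟶ L'} {g' : L' ⟶ X'} (hg' : IsSES k' g') {k : K ⟶ L} {g : L ⟶ X''}
    (hg : IsSES k g) (hL' : A L') (hL : A L) (hK' : B K') (hK : B K) (hX : B X) :
    ∃ (E : ModuleCat.{u} R) (a : L' ⟶ E) (b : E ⟶ L) (φ : E ⟶ X), IsSES a b ∧
      a ≫ φ = g' ≫ f' ∧ φ ≫ f = b ≫ g ∧ A E ∧ B E := by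
  -- `L ⟶ X''` need not lift to `X`, so `L' ⊕ L` will not do for `E`. Instead, the extension of `L`
  -- by `X'` pulled back from `X` is lifted to an extension of `L` by `L'`. It is represented by a
  -- map `N ⟶ X'`, which lifts to `L'` because `N` is in `A` and `K'` in `B`; pushing out along the
  -- lift gives `E`.
  obtain ⟨P, N, n, q, hP, hnq⟩ := exists_projective_isSES L
  have hN : A N := D.left_sub hnq (D.left_of_projective P) hL
  have := hf.shortExact.epi_g
  let t : P ⟶ X := Projective.factorThru (q ≫ g) f
  have ht : t ≫ f = q ≫ g := Projective.factorThru_comp _ _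
  obtain ⟨s, hs⟩ := hf.exists_lift (n ≫ t) (by
    rw [Category.assoc, ht, ← Category.assoc, hnq.comp_eq_zero, Limits.zero_comp])
  obtain ⟨r, rfl⟩ := D.lift hg' hK' hN s
  obtain ⟨E, a, b, hab, H⟩ := hnq.exists_pushout r
  obtain ⟨φ, hφ, hφ'⟩ := H X (g' ≫ f') t (by rw [← hs, Category.assoc])
  have hφ'' := hφ' _ f g (by rw [Category.assoc, hf.comp_eq_zero, Limits.comp_zero]) ht
  exact ⟨E, a, b, φ, hab, hφ, hφ'', D.left_middle hab hL' hL,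
    D.right_of_ses_map hf hg' hg hab hφ hφ'' hK' hK hX⟩

/-- An exact complex with components in `B` receives a map from an exact complex with cycles
in `A` and components in `A ⊓ B` that induces special precovers on cycles. -/
lemma CotorsionData.exists_tilde_precover {X : ChainComplex (ModuleCat.{u} R) ℤ}
    (hX : X.Acyclic) (hB : dw B X) :
    ∃ (V : ChainComplex (ModuleCat.{u} R) ℤ) (φ : V ⟶ X), tilde A V ∧
      (∀ n, A (V.X n) ∧ B (V.X n)) ∧ ∀ n, ∃ (K : ModuleCat.{u} R) (k : K ⟶ V.cycles n),
        B K ∧ IsSES k (HomologicalComplex.cyclesMap φ n) := by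
  -- `Z m` covers the cycles in degree `m - 1`, to match the indexing of `splice`. Quantifying over
  -- `n` with `m = n + 1` avoids transport along `n + 1 - 1 = n`.
  have H : ∀ m : ℤ, ∃ Z : ModuleCat.{u} R, A Z ∧ ∀ n : ℤ, m = n + 1 →
      ∃ (K : ModuleCat.{u} R) (k : K ⟶ Z) (g : Z ⟶ X.cycles n), B K ∧ IsSES k g := by
    intro m
    obtain ⟨K, Z, k, g, hK, hZ, h⟩ := D.precover (X.cycles (m - 1))
    refine ⟨Z, hZ, fun n hn => ?_⟩
    obtain rfl : n = m - 1 := by lia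
    exact ⟨K, k, g, hK, h⟩
  choose Z hZ K k g hK hg using H
  have H' : ∀ n : ℤ, ∃ (E : ModuleCat.{u} R) (a : Z (n + 1) ⟶ E) (b : E ⟶ Z n)
      (φ : E ⟶ X.X n), IsSES a b ∧ a ≫ φ = g (n + 1) n rfl ≫ X.iCycles n ∧
      (∀ (j : ℤ) (hj : n = j + 1), φ ≫ X.toCycles n j = b ≫ g n j hj) ∧ A E ∧ B E := by
    intro n
    obtain ⟨m, rfl⟩ : ∃ m, n = m + 1 := ⟨n - 1, (sub_add_cancel n 1).symm⟩
    obtain ⟨E, a, b, φ, h₁, h₂, h₃, h₄⟩ := D.horseshoe (isSES_cycles hX (i := m + 1) rfl)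
      (hg (m + 1 + 1) (m + 1) rfl) (hg (m + 1) m rfl) (hZ _) (hZ _) (hK _ _ _) (hK _ _ _) (hB _)
    refine ⟨E, a, b, φ, h₁, h₂, fun j hj => ?_, h₄⟩
    obtain rfl : j = m := add_right_cancel hj.symm
    exact h₃
  choose E a b φ hab haφ hφ hE using H'
  have hcomm : ∀ i j, (ComplexShape.down ℤ).Rel i j →
      φ i ≫ X.d i j = (splice a b hab).d i j ≫ φ j := by
    rintro _ j rfl
    rw [splice_d, ← X.toCycles_i, ← Category.assoc, hφ (j + 1) j rfl, Category.assoc,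
      Category.assoc, haφ]
  let Φ : splice a b hab ⟶ X := { f := φ, comm' := hcomm }
  refine ⟨splice a b hab, Φ, ⟨splice_acyclic a b hab, fun n => ?_⟩, hE, fun n => ?_⟩
  · obtain ⟨e, -⟩ := exists_splice_cyclesIso a b hab n
    exact D.left_of_iso e (hZ _)
  · obtain ⟨e, he⟩ := exists_splice_cyclesIso a b hab n
    have h : e.hom ≫ HomologicalComplex.cyclesMap Φ n = g (n + 1) n rfl := by
      rw [← cancel_mono (X.iCycles n), Category.assoc, HomologicalComplex.cyclesMap_i,
        ← Category.assoc, he]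
      exact haφ n
    have h' : HomologicalComplex.cyclesMap Φ n = e.inv ≫ g (n + 1) n rfl := by
      rw [← h, Iso.inv_hom_id_assoc]
    refine ⟨K (n + 1) n rfl, k (n + 1) n rfl ≫ e.hom, hK _ _ _, ?_⟩
    apply IsSES.of_shortExact (S := ShortComplex.mk (k (n + 1) n rfl ≫ e.hom)
      (HomologicalComplex.cyclesMap Φ n)
      (by rw [Category.assoc, h, (hg (n + 1) n rfl).comp_eq_zero]))
    refine ShortComplex.shortExact_of_iso ?_ (hg (n + 1) n rfl).shortExact
    exact ShortComplex.isoMk (Iso.refl _) e (Iso.refl _) (by simp) (by simp [h])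

/-- If exact complexes in `dw (A ⊓ B)` have cycles in `B`, so do exact complexes in `dw B`. -/
lemma CotorsionData.tilde_of_forall_right_cycles
    (H : ∀ X : ChainComplex (ModuleCat.{u} R) ℤ, X.Acyclic → (∀ n : ℤ, A (X.X n) ∧ B (X.X n)) →
      ∀ n : ℤ, B (X.cycles n))
    {X : ChainComplex (ModuleCat.{u} R) ℤ} (hX : X.Acyclic) (hB : dw B X) : tilde B X := by
  refine ⟨hX, fun n => ?_⟩
  obtain ⟨V, φ, hV, hV', h⟩ := D.exists_tilde_precover hX hB
  obtain ⟨K, k, hK, hk⟩ := h n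
  exact D.right_quotient hk hK (H V hV.1 hV' n)

/-- Exact dg-`B` complexes have cycles in `B`. -/
lemma CotorsionData.tilde_of_dgRight {X : ChainComplex (ModuleCat.{u} R) ℤ} (hX : X.Acyclic)
    (hB : dgRight A B X) : tilde B X := by
  refine ⟨hX, fun n => ?_⟩
  obtain ⟨V, φ, hV, -, h⟩ := D.exists_tilde_precover hX hB.1
  obtain ⟨m, rfl⟩ : ∃ m, n = m + 1 := ⟨n - 1, by lia⟩
  obtain ⟨K, k, hK, hk⟩ := h m
  obtain ⟨s⟩ := hB.2 V hV φ
  -- On cycles the term of the homotopy that begins with the differential of `V` vanishes, so `φ`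
  -- factors there through `X.X (m + 1)`.
  have hs : HomologicalComplex.cyclesMap φ m =
      (V.iCycles m ≫ s.hom m (m + 1)) ≫ X.toCycles (m + 1) m := by
    rw [← cancel_mono (X.iCycles m), HomologicalComplex.cyclesMap_i, s.comm,
      dNext_eq _ (show (ComplexShape.down ℤ).Rel m (m - 1) by simp),
      prevD_eq _ (show (ComplexShape.down ℤ).Rel (m + 1) m by simp)]
    simp
  refine D.right_of_lift (isSES_cycles hX (i := m + 1) rfl) (hB.1 _) fun {W} hW c => ?_
  obtain ⟨l, rfl⟩ := D.lift hk hK hW c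
  exact ⟨l ≫ V.iCycles m ≫ s.hom m (m + 1), by rw [hs, Category.assoc]⟩

end Horseshoe

/-! ### Maps from `tilde A` to `tilde B` are null-homotopic -/

section NullHomotopy

variable {R : Type u} [Ring R] {A B : ObjectProperty (ModuleCat.{u} R)} (D : CotorsionData A B)
include D

lemma CotorsionData.right_of_tilde {U : ChainComplex (ModuleCat.{u} R) ℤ} (hU : tilde B U) :
    dw B U := fun _ =>
  D.right_middle (isSES_cycles hU.1 (sub_add_cancel _ 1)) (hU.2 _) (hU.2 _)

lemma CotorsionData.nullHomotopic_of_tilde {V U : ChainComplex (ModuleCat.{u} R) ℤ}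
    (hV : tilde A V) (hU : tilde B U) (f : V ⟶ U) : Nonempty (Homotopy f 0) := by
  -- The homotopy is first chosen on cycles (`a`) and extended to components (`a'`). What remains of
  -- `f` factors through the next cycles as `b`, but `b` need not equal `a`. The difference `b - a`
  -- has values in cycles of `U`, so its extension `c` to components corrects `a'` without changing
  -- `a' ≫ d`.
  have hVc (i : ℤ) := isSES_cycles hV.1 (sub_add_cancel i 1)
  have ha : ∀ i, ∃ a : V.cycles i ⟶ U.X (i + 1),
      a ≫ U.toCycles (i + 1) i = HomologicalComplex.cyclesMap f i := fun i =>
    D.lift (isSES_cycles hU.1 rfl) (hU.2 _) (hV.2 _) _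
  choose a ha using ha
  have ha' : ∀ i, ∃ a' : V.X i ⟶ U.X (i + 1), V.iCycles i ≫ a' = a i := fun i =>
    D.extend (hVc i) (hV.2 _) (D.right_of_tilde hU _) _
  choose a' ha' using ha'
  have had : ∀ i, a i ≫ U.d (i + 1) i = V.iCycles i ≫ f.f i := fun i => by
    rw [← U.toCycles_i, ← Category.assoc, ha, HomologicalComplex.cyclesMap_i]
  have hb : ∀ i, ∃ b : V.cycles i ⟶ U.X (i + 1),
      V.toCycles (i + 1) i ≫ b = f.f (i + 1) - a' (i + 1) ≫ U.d (i + 1 + 1) (i + 1) := fun i =>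
    (isSES_cycles hV.1 (i := i + 1) rfl).exists_desc _ (by
      rw [Preadditive.comp_sub, ← Category.assoc, ha', had, sub_self])
  choose b hb using hb
  have hba : ∀ i, (b i - a i) ≫ U.d (i + 1) i = 0 := fun i => by
    have := (isSES_cycles hV.1 (i := i + 1) rfl).shortExact.epi_g
    dsimp at this
    rw [← cancel_epi (V.toCycles (i + 1) i), Limits.comp_zero, Preadditive.sub_comp,
      Preadditive.comp_sub, had, ← Category.assoc, hb, ← Category.assoc, V.toCycles_i, ← f.comm,
      Preadditive.sub_comp, Category.assoc, U.d_comp_d]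
    simp
  have hc : ∀ i, ∃ c : V.X i ⟶ U.cycles (i + 1),
      V.iCycles i ≫ c ≫ U.iCycles (i + 1) = b i - a i := fun i => by
    obtain ⟨c, hc⟩ := D.extend (hVc i) (hV.2 _) (hU.2 (i + 1))
      (U.liftCycles (b i - a i) i ((ComplexShape.down ℤ).next_eq' rfl) (hba i))
    exact ⟨c, by rw [← Category.assoc, hc, U.liftCycles_i]⟩
  choose c hc using hc
  let h : ∀ i j : ℤ, (ComplexShape.down ℤ).Rel j i → (V.X i ⟶ U.X j) := fun i j hij =>
    (a' i + c i ≫ U.iCycles (i + 1)) ≫ (U.XIsoOfEq hij).hom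
  have hh : ∀ i, h i (i + 1) rfl = a' i + c i ≫ U.iCycles (i + 1) := fun i => by
    simp [h]
  have hf : f = Homotopy.nullHomotopicMap' h := by
    ext1 n
    obtain ⟨i, rfl⟩ : ∃ i, n = i + 1 := ⟨n - 1, (sub_add_cancel n 1).symm⟩
    rw [Homotopy.nullHomotopicMap'_f (k₂ := i + 1 + 1) (k₁ := i + 1) (k₀ := i) rfl rfl, hh, hh,
      ← V.toCycles_i, Category.assoc, Preadditive.comp_add, hc, ha', add_sub_cancel, hb,
      Preadditive.add_comp, Category.assoc, U.iCycles_d]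
    simp
  rw [hf]
  exact ⟨Homotopy.nullHomotopy' h⟩

end NullHomotopy

/-! ### Killing homology by a homotopy fiber -/

section Killing

variable {R : Type u} [Ring R] (W : ChainComplex (ModuleCat.{v} R) ℤ) {E : ℤ → ModuleCat.{v} R}
  (j : ∀ n, W.X n ⟶ E n) (hj : ∀ n, Function.Exact (W.d (n + 1) n) (j n))

/-- The differential of `killing`. -/
noncomputable def killingD (n : ℤ) :
    ModuleCat.of R (W.X (n + 1) × E (n + 1 + 1)) ⟶ ModuleCat.of R (W.X n × E (n + 1)) :=
  ModuleCat.ofHom (((W.d (n + 1) n).hom.prod (j (n + 1)).hom) ∘ₗ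
    LinearMap.fst R (W.X (n + 1)) (E (n + 1 + 1)))

include hj in
lemma killingD_comp_killingD (n : ℤ) : killingD W j (n + 1) ≫ killingD W j n = 0 :=
  ModuleCat.hom_ext (LinearMap.ext fun x => Prod.ext
    (comp_apply_of_eq (W.d_comp_d (n + 1 + 1) (n + 1) n) x.1)
    ((hj (n + 1)).apply_apply_eq_zero x.1))

/-- The homotopy fiber of a map from `W` to a complex with components `E n` and zero
differentials. -/
noncomputable def killing : ChainComplex (ModuleCat.{v} R) ℤ :=
  ChainComplex.of (fun n => ModuleCat.of R (W.X n × E (n + 1))) (killingD W j)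
    (killingD_comp_killingD W j hj)

lemma killing_d_apply (n : ℤ) (x : W.X (n + 1) × E (n + 1 + 1)) :
    (killing W j hj).d (n + 1) n x = (W.d (n + 1) n x.1, j (n + 1) x.1) := by
  have : (killing W j hj).d (n + 1) n = killingD W j n :=
    ChainComplex.of_d (fun n => ModuleCat.of R (W.X n × E (n + 1))) (killingD W j) n
  rw [this]
  rfl

/-- The projection from the homotopy fiber. -/
noncomputable def killingπ : killing W j hj ⟶ W where
  f n := ModuleCat.ofHom (LinearMap.fst R (W.X n) (E (n + 1)))
  comm' := by
    rintro _ n rfl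
    refine ModuleCat.hom_ext (LinearMap.ext fun x => ?_)
    exact (congrArg Prod.fst (killing_d_apply W j hj n x)).symm

lemma isSES_killingπ (n : ℤ) :
    IsSES (Y := (killing W j hj).X n) (ModuleCat.ofHom (LinearMap.inr R (W.X n) (E (n + 1))))
      ((killingπ W j hj).f n) where
  inj := LinearMap.inr_injective
  exact x := ⟨fun h => ⟨x.2, Prod.ext (Eq.symm h) rfl⟩, by rintro ⟨y, rfl⟩; rfl⟩
  surj := LinearMap.fst_surjective

/-- The second coordinate of the differential is `j`, whose kernel consists of boundaries; hence the
projection is zero on homology. -/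
lemma exists_d_eq_killingπ (n : ℤ) (x : (killing W j hj).X (n + 1))
    (hx : (killing W j hj).d (n + 1) n x = 0) :
    ∃ y, W.d (n + 1 + 1) (n + 1) y = (killingπ W j hj).f (n + 1) x := by
  have h := killing_d_apply W j hj n x
  rw [hx] at h
  exact (hj (n + 1) _).1 (congrArg Prod.snd h).symm

/-- A map to the homotopy fiber from a map to `W` and a null-homotopy. -/
lemma exists_lift_killing {V : ChainComplex (ModuleCat.{v} R) ℤ} (f : V ⟶ W)
    (g : ∀ n, V.X n ⟶ E (n + 1)) (hg : ∀ n, V.d (n + 1) n ≫ g n = f.f (n + 1) ≫ j (n + 1)) :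
    ∃ f' : V ⟶ killing W j hj, f' ≫ killingπ W j hj = f := by
  let f' : V ⟶ killing W j hj :=
    { f := fun n => ModuleCat.ofHom ((f.f n).hom.prod (g n).hom)
      comm' := by
        rintro _ n rfl
        refine ModuleCat.hom_ext (LinearMap.ext fun x => ?_)
        exact (killing_d_apply W j hj n _).trans (Prod.ext (comp_apply_of_sq (f.comm _ _) x)
          (comp_apply_of_sq (hg n) x).symm) }
  exact ⟨f', by ext; rfl⟩

variable {A B : ObjectProperty (ModuleCat.{u} R)} (D : CotorsionData A B)
include D

lemma CotorsionData.exists_killing {W : ChainComplex (ModuleCat.{u} R) ℤ} (hW : dw B W) :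
    ∃ (W' : ChainComplex (ModuleCat.{u} R) ℤ) (p : W' ⟶ W), dw B W' ∧
      (∀ n, ∃ (K : ModuleCat.{u} R) (k : K ⟶ W'.X n), B K ∧ IsSES k (p.f n)) ∧
      (∀ n (x : W'.X (n + 1)), W'.d (n + 1) n x = 0 →
        ∃ y, W.d (n + 1 + 1) (n + 1) y = p.f (n + 1) x) ∧
      ∀ (V : ChainComplex (ModuleCat.{u} R) ℤ) (f : V ⟶ W), tilde A V → ∃ f', f' ≫ p = f := by
  -- Embed the cokernel of the incoming differential in an object of `B`.
  have H : ∀ n, ∃ (E : ModuleCat.{u} R) (j : W.X n ⟶ E), B E ∧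
      Function.Exact (W.d (n + 1) n) j := fun n => by
    let S := LinearMap.range (W.d (n + 1) n).hom
    obtain ⟨E, e, hE, he⟩ := D.preenvelope (ModuleCat.of R (W.X n ⧸ S))
    refine ⟨E, ModuleCat.ofHom S.mkQ ≫ e, hE, fun x => ?_⟩
    rw [ConcreteCategory.comp_apply, map_eq_zero_iff _ he]
    exact Submodule.Quotient.mk_eq_zero S
  choose E j hE hj using H
  refine ⟨killing W j hj, killingπ W j hj,
    fun n => D.right_middle (isSES_killingπ W j hj n) (hE _) (hW n),
    fun n => ⟨_, _, hE _, isSES_killingπ W j hj n⟩, exists_d_eq_killingπ W j hj,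
    fun V f hV => ?_⟩
  have hg : ∀ n, ∃ g : V.X n ⟶ E (n + 1), V.d (n + 1) n ≫ g = f.f (n + 1) ≫ j (n + 1) := by
    intro n
    -- Cycles of `V` are boundaries, so `f` sends them to boundaries, which `j` kills. The induced
    -- map on `V.cycles n` then extends to `V.X n`, as the quotient is in `A` and the target in `B`;
    -- this is the null-homotopy that lifts `f`.
    obtain ⟨g, hg⟩ := (isSES_cycles hV.1 (i := n + 1) rfl).exists_desc (f.f (n + 1) ≫ j (n + 1)) (by
      ext z
      obtain ⟨v, rfl⟩ := toCycles_surjective hV.1 (i := n + 1 + 1) rfl z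
      change j (n + 1) (f.f (n + 1) (V.iCycles (n + 1) (V.toCycles (n + 1 + 1) (n + 1) v))) = 0
      rw [toCycles_iCycles_apply, ← comp_apply_of_sq (f.comm _ _)]
      exact (hj (n + 1)).apply_apply_eq_zero _)
    obtain ⟨g', rfl⟩ := D.extend (isSES_cycles hV.1 (sub_add_cancel n 1)) (hV.2 _) (hE (n + 1)) g
    exact ⟨g', by rw [← hg, ← Category.assoc, V.toCycles_i]⟩
  choose g hg using hg
  exact exists_lift_killing W j hj f g hg

end Killing

/-! ### Inverse limits of towers of complexes -/

section Tower

lemma exists_tower_of_step {α : Type*} {β : α → α → Type*} (r : ∀ a' a, β a' a → Prop) (a : α)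
    (h : ∀ a, ∃ a' f, r a' a f) :
    ∃ (T : ℕ → α) (p : ∀ j, β (T (j + 1)) (T j)), T 0 = a ∧ ∀ j, r _ _ (p j) := by
  choose F p hp using h
  exact ⟨fun j => Nat.rec a (fun _ => F) j, fun j => p _, rfl, fun j => hp _⟩

lemma exists_seq_of_step {α : ℕ → Type*} (r : ∀ j, α (j + 1) → α j → Prop) (a : α 0)
    (h : ∀ j x, ∃ y, r j y x) : ∃ x : ∀ j, α j, x 0 = a ∧ ∀ j, r j (x (j + 1)) (x j) := by
  choose F hF using h
  exact ⟨fun j => Nat.rec a F j, rfl, fun j => hF j _⟩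

variable {R : Type u} [Ring R] {T : ℕ → ChainComplex (ModuleCat.{v} R) ℤ}
  (p : ∀ j, T (j + 1) ⟶ T j)

/-- The compatible sequences of elements of degree `n` in a tower of complexes. -/
def towerSubmodule (n : ℤ) : Submodule R (∀ j, (T j).X n) where
  carrier := {x | ∀ j, (p j).f n (x (j + 1)) = x j}
  add_mem' hx hy j := by simp [hx j, hy j]
  zero_mem' j := by simp
  smul_mem' r x hx j := by simp [hx j]

/-- The inverse limit of a tower of complexes. -/
def towerLimit : ChainComplex (ModuleCat.{v} R) ℤ where
  X n := ModuleCat.of R (towerSubmodule p n)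
  d i k := ModuleCat.ofHom (LinearMap.restrict
    (LinearMap.pi fun j => ((T j).d i k).hom ∘ₗ LinearMap.proj j) (fun x hx j => by
      change (p j).f k ((T (j + 1)).d i k (x (j + 1))) = (T j).d i k (x j)
      rw [← hx j]
      exact (comp_apply_of_sq ((p j).comm i k) _).symm))
  shape i k h := by
    refine ModuleCat.hom_ext (LinearMap.ext fun x => Subtype.ext (funext fun j => ?_))
    change (T j).d i k (x.1 j) = 0
    rw [(T j).shape i k h]
    rfl
  d_comp_d' i k l _ _ := by
    refine ModuleCat.hom_ext (LinearMap.ext fun x => Subtype.ext (funext fun j => ?_))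
    exact comp_apply_of_eq ((T j).d_comp_d i k l) (x.1 j)

/-- The projections from the inverse limit of a tower of complexes. -/
def towerLimitπ (j : ℕ) : towerLimit p ⟶ T j where
  f n := ModuleCat.ofHom (LinearMap.proj j ∘ₗ (towerSubmodule p n).subtype)

lemma exists_lift_towerLimit {V : ChainComplex (ModuleCat.{v} R) ℤ} (f : ∀ j, V ⟶ T j)
    (hf : ∀ j, f (j + 1) ≫ p j = f j) :
    ∃ g : V ⟶ towerLimit p, ∀ j, g ≫ towerLimitπ p j = f j := by
  let g : V ⟶ towerLimit p :=
    { f := fun n => ModuleCat.ofHom (LinearMap.codRestrict (towerSubmodule p n)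
        (LinearMap.pi fun j => ((f j).f n).hom) fun x j =>
          comp_apply_of_eq (HomologicalComplex.congr_hom (hf j) n) x)
      comm' := fun i k _ => by
        refine ModuleCat.hom_ext (LinearMap.ext fun x => Subtype.ext (funext fun j => ?_))
        exact comp_apply_of_sq ((f j).comm i k) x }
  exact ⟨g, fun j => by ext; rfl⟩

/-- The inverse limit of a tower of surjections that are zero in homology is acyclic. -/
lemma towerLimit_acyclic (hp : ∀ j n, Function.Surjective ((p j).f n))
    (hz : ∀ j n (x : (T (j + 1)).X (n + 1)), (T (j + 1)).d (n + 1) n x = 0 →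
      ∃ y, (T j).d (n + 1 + 1) (n + 1) y = (p j).f (n + 1) x) : (towerLimit p).Acyclic := by
  intro n
  obtain ⟨n, rfl⟩ : ∃ m, n = m + 1 := ⟨n - 1, (sub_add_cancel n 1).symm⟩
  rw [exactAt_iff_exact _ rfl rfl]
  intro z
  constructor
  swap
  · rintro ⟨y, rfl⟩
    exact comp_apply_of_eq ((towerLimit p).d_comp_d _ _ _) y
  intro hzero
  have hdp : ∀ j i k (x : (T (j + 1)).X i),
      (T j).d i k ((p j).f i x) = (p j).f k ((T (j + 1)).d i k x) :=
    fun j i k x => comp_apply_of_sq ((p j).comm i k) x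
  have hzc : ∀ j, (p j).f (n + 1) (z.1 (j + 1)) = z.1 j := z.2
  have hzd : ∀ j, (T j).d (n + 1) n (z.1 j) = 0 := fun j =>
    congrFun (congrArg Subtype.val hzero) j
  have hbd : ∀ j, ∃ y, (T j).d (n + 1 + 1) (n + 1) y = z.1 j := fun j => by
    obtain ⟨y, hy⟩ := hz j n _ (hzd (j + 1))
    exact ⟨y, hy.trans (hzc j)⟩
  -- A Mittag-Leffler argument. The primitives `t j` live one level above `z j`, since a correction
  -- by a boundary is possible only after one more projection: two primitives differ by a cycle,
  -- which becomes a boundary one level down. Compatibility is therefore asked only of the images in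
  -- `T j`.
  let α : ℕ → Type _ := fun j =>
    {t : (T (j + 1)).X (n + 1 + 1) // (T (j + 1)).d (n + 1 + 1) (n + 1) t = z.1 (j + 1)}
  obtain ⟨t₀, ht₀⟩ := hbd 1
  obtain ⟨t, -, ht⟩ := exists_seq_of_step (α := α)
    (fun j s t => (p j).f _ ((p (j + 1)).f _ s.1) = (p j).f _ t.1) ⟨t₀, ht₀⟩ (by
      rintro j ⟨t, ht⟩
      obtain ⟨y, hy⟩ := hbd (j + 1 + 1)
      obtain ⟨b, hb⟩ := hz j (n + 1) ((p (j + 1)).f _ y - t) (by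
        rw [map_sub, hdp, hy, ht, hzc, sub_self])
      -- Lift `b` through two levels, so that its boundary can be subtracted from `y`.
      obtain ⟨b, rfl⟩ := hp j _ b
      obtain ⟨b, rfl⟩ := hp (j + 1) _ b
      refine ⟨⟨y - (T (j + 1 + 1)).d _ _ b, ?_⟩, ?_⟩
      · rw [map_sub, hy, comp_apply_of_eq ((T (j + 1 + 1)).d_comp_d _ _ _)]
        exact sub_zero _
      · dsimp only
        rw [map_sub, map_sub, ← hdp, ← hdp, hb, map_sub, sub_sub_cancel])
  refine ⟨⟨fun j => (p j).f _ (t j).1, fun j => ht j⟩, Subtype.ext (funext fun j => ?_)⟩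
  change (T j).d _ _ ((p j).f _ (t j).1) = z.1 j
  rw [hdp, (t j).2, hzc]

variable {A B : ObjectProperty (ModuleCat.{u} R)} (D : CotorsionData A B)
  {T : ℕ → ChainComplex (ModuleCat.{u} R) ℤ} (p : ∀ j, T (j + 1) ⟶ T j)
include D

/-- This is the dual of Eklof's lemma: extensions of a map are built level by level. Two extensions
at one level differ by a map from the cokernel, which is in `A`, and this map lifts to the next
level because the kernel of the transition map is in `B`. -/
lemma CotorsionData.right_towerLimit (hT : ∀ j, dw B (T j))
    (hp : ∀ j n, ∃ (K : ModuleCat.{u} R) (k : K ⟶ (T (j + 1)).X n), B K ∧ IsSES k ((p j).f n)) :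
    dw B (towerLimit p) := by
  intro n
  refine D.right_of_extend fun {X Y Z f g} h hZ c => ?_
  let cj : ∀ j, X ⟶ (T j).X n := fun j => c ≫ (towerLimitπ p j).f n
  have hcj : ∀ j, cj (j + 1) ≫ (p j).f n = cj j := fun j =>
    ModuleCat.hom_ext (LinearMap.ext fun x => (c x).2 j)
  let α : ℕ → Type _ := fun j => {l : Y ⟶ (T j).X n // f ≫ l = cj j}
  obtain ⟨l₀, hl₀⟩ := D.extend h hZ (hT 0 n) (cj 0)
  obtain ⟨l, -, hl⟩ := exists_seq_of_step (α := α) (fun j m l => m.1 ≫ (p j).f n = l.1)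
    ⟨l₀, hl₀⟩ (by
      rintro j ⟨l, hl⟩
      obtain ⟨m, hm⟩ := D.extend h hZ (hT (j + 1) n) (cj (j + 1))
      obtain ⟨K, k, hK, hk⟩ := hp j n
      obtain ⟨s, hs⟩ := h.exists_desc (l - m ≫ (p j).f n) (by
        rw [Preadditive.comp_sub, hl, ← Category.assoc, hm, hcj, sub_self])
      obtain ⟨s', hs'⟩ := D.lift hk hK hZ s
      refine ⟨⟨m + g ≫ s', ?_⟩, ?_⟩
      · rw [Preadditive.comp_add, hm, ← Category.assoc, h.comp_eq_zero]
        simp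
      · dsimp only
        rw [Preadditive.add_comp, Category.assoc, hs', hs, add_sub_cancel])
  refine ⟨ModuleCat.ofHom (LinearMap.codRestrict (towerSubmodule p n)
    (LinearMap.pi fun j => (l j).1.hom) fun y j => comp_apply_of_eq (hl j) y), ?_⟩
  refine ModuleCat.hom_ext (LinearMap.ext fun x => Subtype.ext (funext fun j => ?_))
  exact comp_apply_of_eq (l j).2 x

/-- Every chain map from `V` in `tilde A` to `W` in `dw B` factors through an acyclic complex
in `dw B`, which does not depend on `V`. -/
lemma CotorsionData.exists_acyclic_factorization {W : ChainComplex (ModuleCat.{u} R) ℤ}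
    (hW : dw B W) : ∃ (U : ChainComplex (ModuleCat.{u} R) ℤ) (q : U ⟶ W), U.Acyclic ∧ dw B U ∧
      ∀ (V : ChainComplex (ModuleCat.{u} R) ℤ) (f : V ⟶ W), tilde A V → ∃ g, g ≫ q = f := by
  -- Membership in `dw B` is part of the objects of the tower, so that the killing step can be
  -- iterated.
  obtain ⟨T, p, hT₀, hT⟩ := exists_tower_of_step
    (α := {W : ChainComplex (ModuleCat.{u} R) ℤ // dw B W}) (β := fun W' W => W'.1 ⟶ W.1)
    (fun W' W p =>
      (∀ n, ∃ (K : ModuleCat.{u} R) (k : K ⟶ W'.1.X n), B K ∧ IsSES k (p.f n)) ∧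
      (∀ n (x : W'.1.X (n + 1)), W'.1.d (n + 1) n x = 0 →
        ∃ y, W.1.d (n + 1 + 1) (n + 1) y = p.f (n + 1) x) ∧
      ∀ (V : ChainComplex (ModuleCat.{u} R) ℤ) (f : V ⟶ W.1), tilde A V → ∃ f', f' ≫ p = f)
    ⟨W, hW⟩ (fun W => by
      obtain ⟨W', p, hW', h⟩ := D.exists_killing W.2
      exact ⟨⟨W', hW'⟩, p, h⟩)
  obtain rfl : (T 0).1 = W := congrArg Subtype.val hT₀
  refine ⟨towerLimit (T := fun j => (T j).1) p, towerLimitπ (T := fun j => (T j).1) p 0,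
    towerLimit_acyclic (T := fun j => (T j).1) p (fun j n => ?_) (fun j => (hT j).2.1),
    D.right_towerLimit (T := fun j => (T j).1) p (fun j => (T j).2) (fun j => (hT j).1),
    fun V f hV => ?_⟩
  · obtain ⟨K, k, -, h⟩ := (hT j).1 n
    exact h.surj
  · obtain ⟨F, hF, hF'⟩ := exists_seq_of_step (α := fun j => V ⟶ (T j).1)
      (fun j g f => g ≫ p j = f) f (fun j f => (hT j).2.2 V f hV)
    obtain ⟨g, hg⟩ := exists_lift_towerLimit (T := fun j => (T j).1) p F hF'
    exact ⟨g, (hg 0).trans hF⟩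

/-- If exact complexes in `dw B` have cycles in `B`, then all complexes in `dw B` are dg-`B`. -/
lemma CotorsionData.dgRight_of_forall_tilde
    (H : ∀ X : ChainComplex (ModuleCat.{u} R) ℤ, X.Acyclic → dw B X → tilde B X)
    {W : ChainComplex (ModuleCat.{u} R) ℤ} (hW : dw B W) : dgRight A B W := by
  refine ⟨hW, fun V hV f => ?_⟩
  obtain ⟨U, q, hU, hUB, h⟩ := D.exists_acyclic_factorization hW
  obtain ⟨g, rfl⟩ := h V f hV
  obtain ⟨s⟩ := D.nullHomotopic_of_tilde hV (H U hU hUB) g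
  exact ⟨(s.compRight q).trans (Homotopy.ofEq Limits.zero_comp)⟩

end Tower

end Cotorsion

theorem lemma2 {R : Type u} [Ring R] (A B : ObjectProperty (ModuleCat.{u} R))
    (hpair : Cotorsion.IsCotorsionPair.{u} A B)
    (hcomplete : Cotorsion.IsComplete A B)
    (hhereditary : Cotorsion.IsHereditary.{u} A B) :
    List.TFAE
      [∀ X : ChainComplex (ModuleCat.{u} R) ℤ, X.Acyclic → (∀ n : ℤ, A (X.X n) ∧ B (X.X n)) →
          ∀ n : ℤ, B (X.cycles n),
       ∀ X : ChainComplex (ModuleCat.{u} R) ℤ, X.Acyclic → Cotorsion.dw B X →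
          Cotorsion.tilde B X,
       ∀ X : ChainComplex (ModuleCat.{u} R) ℤ, Cotorsion.dw B X →
          Cotorsion.dgRight A B X] := by
  have D := hpair.cotorsionData hcomplete hhereditary
  tfae_have 1 → 2 := fun H X hX hB => D.tilde_of_forall_right_cycles H hX hB
  tfae_have 2 → 1 := fun H X hX hAB => (H X hX fun n => (hAB n).2).2
  tfae_have 2 → 3 := fun H X hB => D.dgRight_of_forall_tilde H hB
  tfae_have 3 → 2 := fun H X hX hB => D.tilde_of_dgRight hX (H X hB)
  tfae_finish
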